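/- For a polynomial $f\in\mathbb C[x,y]$ let its amoeba be $$\mathcal A(f)=\{(\log|x|,\log|y|) : x,y\in\mathbb C\setminus\{0\},\ f(x,y)=0\}\subset\mathbb R^2 .$$ Say that $\mathcal A(f)$ has a tentacle stretching out to infinity in the direction of a vector $v\in\mathbb R^2\setminus\{0\}$ if there is a point $p\in\mathbb R^2$ such that the distance from $p+tv$ to $\mathcal A(f)$ tends to $0$ as $t\to+\infty$ (an empty amoeba has no tentacles). Let $f,g\in\mathbb C[x,y]$ be two polynomials. If there is no direction $v$ in which both $\mathcal A(f)$ and $\mathcal A(g)$ have a tentacle stretching out to infinity, then $f$ and $g$ have no common factor on the torus $(\mathbb C\setminus\{0\})^2$: every common divisor of $f$ and $g$ in $\mathbb C[x,y]$ is a monomial $c\,x^iy^j$ with $c\in\mathbb C\setminus\{0\}$ and $i,j\ge 0$. In particular, if moreover neither $x$ nor $y$ divides both $f$ and $g$, then $f$ and $g$ have no common factor in $\mathbb C[x,y]$, i.e. all their common divisors are nonzero constants. -/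

import Mathlib

open Filter

noncomputable section

/-- The zero set of a bivariate complex polynomial in the torus `(ℂ \ {0})²`. -/
def torusVariety (f : MvPolynomial (Fin 2) ℂ) : Set (Fin 2 → ℂ) :=
  {z | (∀ i, z i ≠ 0) ∧ MvPolynomial.eval z f = 0}

/-- The logarithm map `(x, y) ↦ (log |x|, log |y|)`; it is only applied to points of the torus. -/
def logMap (z : Fin 2 → ℂ) : EuclideanSpace ℝ (Fin 2) :=
  WithLp.toLp 2 fun i => Real.log ‖z i‖

/-- The amoeba of `f`: the image under the logarithm map of the zero set of `f` in the torus. -/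
def amoeba (f : MvPolynomial (Fin 2) ℂ) : Set (EuclideanSpace ℝ (Fin 2)) :=
  logMap '' torusVariety f

/-- The planar set `A` has a tentacle stretching out to infinity in the direction of the nonzero
vector `v`: there is a ray `p + t v`, `t ≥ 0`, whose points come arbitrarily close to `A` as
`t → ∞`, that is, the distance from `p + t v` to `A` tends to `0`. (The condition depends only on
the direction of `v`: it is unchanged when `v` is multiplied by a positive number. It fails for
every `v` if `A` is empty.) -/
def HasTentacle (A : Set (EuclideanSpace ℝ (Fin 2))) (v : EuclideanSpace ℝ (Fin 2)) : Prop :=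
  v ≠ 0 ∧ ∃ p : EuclideanSpace ℝ (Fin 2), ∀ ε : ℝ, 0 < ε →
    ∀ᶠ t : ℝ in atTop, ∃ a ∈ A, dist (p + t • v) a < ε

/-- `h` is a monomial `c x ^ i y ^ j` with nonzero coefficient; these are exactly the polynomials
that become units on the torus. -/
def IsMonomialTerm (h : MvPolynomial (Fin 2) ℂ) : Prop :=
  ∃ (s : Fin 2 →₀ ℕ) (c : ℂ), c ≠ 0 ∧ h = MvPolynomial.monomial s c

end

/-!
A common divisor `h` of `f` and `g` satisfies `amoeba h ⊆ amoeba f ∩ amoeba g`, so every tentacle of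
`amoeba h` is a tentacle of both amoebas. It therefore suffices to show that the amoeba of a
polynomial which is not a monomial has a tentacle.

Such a polynomial `h` is either zero, and then its amoeba is the whole plane, or its Newton polygon
has an edge (`exists_weight_face_nontrivial`): there is a nonzero real weight `v` whose maximum `M`
over the support of `h` is attained at least twice. Substituting `z j = exp (t * v j) * x` for one
coordinate `j` and `z i = exp (t * v i)` for the other one, and multiplying by `exp (-t * M)`, turns
`h` into a family of polynomials in `x` whose coefficients converge, as `t → ∞`, to those of the
restriction of `h` to the edge. That restriction has at least two terms, hence a nonzero root `x₀`,
and roots depend continuously on parameters (`eventually_exists_root_near`, a form of Hurwitz's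
theorem): for large `t` the family has a root `x` close to `x₀`. The logarithms of the resulting
zeros of `h` approach the ray `p + t v`, where `p` has coordinate `log ‖x₀‖` at `j` and `0` at `i`
(`hasTentacle_amoeba_of_face`).
-/

/-! ### Roots of polynomials in one variable -/

/-- Hurwitz's theorem for a family of entire functions that is jointly continuous in the parameter
and the variable: a root of a member that does not vanish identically persists nearby. -/
theorem eventually_exists_root_near {X : Type*} [TopologicalSpace X] {F : X → ℂ → ℂ}
    (hF : Continuous (Function.uncurry F)) (hd : ∀ x, Differentiable ℂ (F x)) {x₀ : X} {z₀ : ℂ}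
    (h₀ : F x₀ z₀ = 0) (hne : ∃ z, F x₀ z ≠ 0) {ε : ℝ} (hε : 0 < ε) :
    ∀ᶠ x in nhds x₀, ∃ z, dist z z₀ < ε ∧ F x z = 0 := by
  have han : ∀ x, AnalyticOnNhd ℂ (F x) Set.univ := fun x z _ => (hd x).analyticAt z
  have hiso : ∀ᶠ z in nhdsWithin z₀ {z₀}ᶜ, F x₀ z ≠ 0 := by
    rcases (han x₀ z₀ trivial).eventually_eq_zero_or_eventually_ne_zero with h | h
    · obtain ⟨z, hz⟩ := hne
      exact absurd ((han x₀).eqOn_zero_of_preconnected_of_eventuallyEq_zero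
        isPreconnected_univ trivial h (Set.mem_univ z)) hz
    · exact h
  obtain ⟨δ, hδ, hδne⟩ := Metric.eventually_nhds_iff.1 (eventually_nhdsWithin_iff.1 hiso)
  obtain ⟨r, hr, hrm⟩ := exists_between (lt_min hδ hε)
  have hsne : ∀ z ∈ Metric.sphere z₀ r, 0 < ‖F x₀ z‖ := fun z hz => by
    refine norm_pos_iff.2 (hδne ?_ ?_)
    · rw [Metric.mem_sphere.1 hz]
      exact hrm.trans_le (min_le_left _ _)
    · rintro rfl
      simp at hz
      exact hr.ne hz
  obtain ⟨m, hm, hmle⟩ : ∃ m > 0, ∀ z ∈ Metric.sphere z₀ r, m < ‖F x₀ z‖ := by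
    obtain ⟨w, hw, hmin⟩ := (isCompact_sphere z₀ r).exists_isMinOn
      (NormedSpace.sphere_nonempty.2 hr.le) (hd x₀).continuous.norm.continuousOn
    exact ⟨‖F x₀ w‖ / 2, half_pos (hsne w hw), fun z hz =>
      (half_lt_self (hsne w hw)).trans_le (hmin hz)⟩
  have hcz : Continuous fun x => F x z₀ := hF.comp (by fun_prop : Continuous fun x => (x, z₀))
  have hsphere : ∀ᶠ x in nhds x₀, ∀ z ∈ Metric.sphere z₀ r, m < ‖F x z - F x z₀‖ := by
    refine (isCompact_sphere z₀ r).eventually_forall_of_forall_eventually fun z hz => ?_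
    have hc : Continuous fun p : X × ℂ => ‖F p.1 p.2 - F p.1 z₀‖ :=
      (hF.sub (hcz.comp continuous_fst)).norm
    refine hc.continuousAt.eventually (lt_mem_nhds ?_)
    simpa [h₀] using hmle z hz
  have hcenter : ∀ᶠ x in nhds x₀, ‖F x z₀‖ < m / 2 := by
    refine hcz.norm.continuousAt.eventually (gt_mem_nhds ?_)
    simpa [h₀] using half_pos hm
  filter_upwards [hsphere, hcenter] with x hxs hxc
  have hfreq : ∃ᶠ z in nhds z₀, F x z ≠ F x z₀ := by
    intro h
    obtain ⟨w, hw⟩ := NormedSpace.sphere_nonempty (x := z₀).2 hr.le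
    have hconst : F x w = F x z₀ :=
      (han x).eqOn_of_preconnected_of_eventuallyEq (g := fun _ => F x z₀)
        (fun _ _ => analyticAt_const) isPreconnected_univ trivial
        (h.mono fun z hz => not_not.1 hz) (Set.mem_univ w)
    have := hxs w hw
    rw [hconst, sub_self, norm_zero] at this
    exact hm.not_gt this
  have himage := (hd x).diffContOnCl.ball_subset_image_closedBall hr
    (fun z hz => (hxs z hz).le) hfreq
  obtain ⟨z, hz, hz0⟩ := himage (show (0 : ℂ) ∈ Metric.ball (F x z₀) (m / 2) by
    simpa [Metric.mem_ball, dist_eq_norm] using hxc)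
  exact ⟨z, (Metric.mem_closedBall.1 hz).trans_lt (hrm.trans_le (min_le_right _ _)), hz0⟩

theorem Polynomial.exists_ne_zero_isRoot_of_coeff_ne_zero {K : Type*} [Field K] [IsAlgClosed K]
    {q : Polynomial K} {m n : ℕ} (hmn : m ≠ n) (hm : q.coeff m ≠ 0) (hn : q.coeff n ≠ 0) :
    ∃ x, x ≠ 0 ∧ q.IsRoot x := by
  have hq : q ≠ 0 := by
    rintro rfl
    simp at hm
  obtain ⟨r, hqr, hr⟩ := q.exists_eq_pow_rootMultiplicity_mul_and_not_dvd hq 0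
  generalize q.rootMultiplicity 0 = k at hqr
  rw [Polynomial.C_0, sub_zero] at hqr hr
  -- A constant cofactor `r` would make `q` a multiple of a power of the variable.
  have hdeg : r.degree ≠ 0 := by
    intro h
    rw [Polynomial.eq_C_of_degree_eq_zero h] at hqr
    simp only [hqr, Polynomial.coeff_mul_C, Polynomial.coeff_X_pow] at hm hn
    have hmk : m = k := by
      by_contra hne
      simp [hne] at hm
    have hnk : n = k := by
      by_contra hne
      simp [hne] at hn
    exact hmn (hmk.trans hnk.symm)
  obtain ⟨x, hx⟩ := IsAlgClosed.exists_root r hdeg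
  refine ⟨x, ?_, ?_⟩
  · rintro rfl
    exact hr (by simpa using Polynomial.dvd_iff_isRoot.2 hx)
  · rw [hqr]
    exact Polynomial.root_mul_left_of_isRoot _ hx

/-! ### Tentacles from edges of the Newton polygon -/

/-- If the weight `v` attains its maximum `M` over the support of `h` at least twice, i.e. `v` is an
outer normal vector of an edge of the Newton polygon, then the amoeba of `h` has a tentacle in the
direction `v`. The condition `v i ≠ 0` ensures that distinct points of the edge differ in
coordinate `j`, so that the edge polynomial keeps its terms when coordinate `i` is set to `1`. -/
theorem hasTentacle_amoeba_of_face (h : MvPolynomial (Fin 2) ℂ) (v : EuclideanSpace ℝ (Fin 2))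
    (M : ℝ) {i j : Fin 2} (hij : i ≠ j) (hvi : v i ≠ 0)
    (hle : ∀ m ∈ h.support, v i * m i + v j * m j ≤ M)
    (hface : ∃ m ∈ h.support, ∃ n ∈ h.support, m ≠ n ∧
      v i * m i + v j * m j = M ∧ v i * n i + v j * n j = M) :
    HasTentacle (amoeba h) v := by
  classical
  have hcov : ∀ k : Fin 2, k = i ∨ k = j := by omega
  have huniv : (Finset.univ : Finset (Fin 2)) = {i, j} := by
    ext k
    simpa using hcov k
  let S := h.support.filter fun m => v i * m i + v j * m j = M
  have hinj : ∀ m ∈ S, ∀ n ∈ S, m j = n j → m = n := by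
    intro m hm n hn hmn
    have h1 := (Finset.mem_filter.1 hm).2
    have h2 := (Finset.mem_filter.1 hn).2
    rw [hmn] at h1
    have h3 : (m i : ℝ) = n i := mul_left_cancel₀ hvi (by linarith)
    ext k
    rcases hcov k with rfl | rfl
    · exact_mod_cast h3
    · exact hmn
  let q : Polynomial ℂ := ∑ m ∈ S, Polynomial.monomial (m j) (h.coeff m)
  have hcoeff : ∀ m ∈ S, q.coeff (m j) ≠ 0 := by
    intro m hm
    have : q.coeff (m j) = h.coeff m := by
      simp only [q, Polynomial.finsetSum_coeff, Polynomial.coeff_monomial]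
      rw [Finset.sum_eq_single_of_mem m hm, if_pos rfl]
      exact fun n hn hne => if_neg fun he => hne (hinj n hn m hm he)
    rw [this]
    exact MvPolynomial.mem_support_iff.1 (Finset.mem_filter.1 hm).1
  obtain ⟨m, hm, n, hn, hmn, hmM, hnM⟩ := hface
  have hmS : m ∈ S := Finset.mem_filter.2 ⟨hm, hmM⟩
  have hnS : n ∈ S := Finset.mem_filter.2 ⟨hn, hnM⟩
  obtain ⟨x₀, hx₀, hroot⟩ := Polynomial.exists_ne_zero_isRoot_of_coeff_ne_zero
    (fun he => hmn (hinj m hmS n hnS he)) (hcoeff m hmS) (hcoeff n hnS)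
  -- Polynomials in one variable, parametrized by coefficients indexed by the support of `h`.
  let F : ((Fin 2 →₀ ℕ) → ℂ) → ℂ → ℂ := fun a z => ∑ m ∈ h.support, a m * z ^ m j
  have hFc : Continuous (Function.uncurry F) := by
    simp only [F, Function.uncurry_def]
    fun_prop
  have hFd : ∀ a, Differentiable ℂ (F a) := fun a => by
    simp only [F]
    fun_prop
  let a₀ : (Fin 2 →₀ ℕ) → ℂ := fun m => if v i * m i + v j * m j = M then h.coeff m else 0
  let a : ℝ → (Fin 2 →₀ ℕ) → ℂ := fun t m =>
    if m ∈ h.support then h.coeff m * (Real.exp (t * (v i * m i + v j * m j - M)) : ℝ) else a₀ m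
  have hF₀ : ∀ z, F a₀ z = q.eval z := fun z => by
    simp only [F, a₀, q, Polynomial.eval_finsetSum, Polynomial.eval_monomial, ite_mul, zero_mul]
    exact (Finset.sum_filter _ _).symm
  have hlim : Tendsto a atTop (nhds a₀) := by
    refine tendsto_pi_nhds.2 fun m => ?_
    by_cases hm : m ∈ h.support
    · simp only [a, a₀, if_pos hm]
      split_ifs with hM
      · simp [hM]
      · have hneg : v i * m i + v j * m j - M < 0 :=
          sub_neg.2 (lt_of_le_of_ne (hle m hm) hM)
        have := Real.tendsto_exp_atBot.comp (tendsto_id.atTop_mul_const_of_neg hneg)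
        simpa using ((Complex.continuous_ofReal.tendsto 0).comp this).const_mul (h.coeff m)
    · simp only [a, if_neg hm]
      exact tendsto_const_nhds
  have hq : ∃ z, F a₀ z ≠ 0 := by
    by_contra! hzero
    have : q = 0 := Polynomial.funext fun z => by simpa [hF₀] using hzero z
    exact hcoeff m hmS (by simp [this])
  let Z : ℝ → ℂ → Fin 2 → ℂ := fun t z k =>
    (Real.exp (t * v k) : ℝ) * if k = j then z else 1
  have hZ : ∀ t z, F (a t) z = 0 → MvPolynomial.eval (Z t z) h = 0 := by
    intro t z hz
    have key : MvPolynomial.eval (Z t z) h = (Real.exp (t * M) : ℝ) * F (a t) z := by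
      rw [MvPolynomial.eval_eq', Finset.mul_sum]
      refine Finset.sum_congr rfl fun m hm => ?_
      rw [huniv, Finset.prod_pair hij]
      simp only [Z, a, if_pos hm, if_neg hij, if_true, mul_one, mul_pow]
      have hexp : Real.exp (t * v i) ^ m i * Real.exp (t * v j) ^ m j =
          Real.exp (t * M) * Real.exp (t * (v i * m i + v j * m j - M)) := by
        rw [← Real.exp_nat_mul, ← Real.exp_nat_mul, ← Real.exp_add, ← Real.exp_add]
        ring_nf
      have hexp' := congrArg (fun r : ℝ => (r : ℂ)) hexp
      push_cast at hexp' ⊢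
      linear_combination (h.coeff m * z ^ m j) * hexp'
    rw [key, hz, mul_zero]
  let p : ℂ → EuclideanSpace ℝ (Fin 2) := fun z =>
    WithLp.toLp 2 fun k => if k = j then Real.log ‖z‖ else 0
  have hlog : ∀ t z, z ≠ 0 → logMap (Z t z) = p z + t • v := by
    intro t z hz
    ext k
    by_cases hk : k = j
    · simp [logMap, Z, p, hk, Real.log_mul, hz, Real.exp_ne_zero, abs_of_pos, Real.exp_pos,
        -Complex.ofReal_exp, add_comm]
    · simp [logMap, Z, p, hk, -Complex.ofReal_exp, abs_of_pos, Real.exp_pos]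
  refine ⟨fun hv => hvi (by simp [hv]), p x₀, fun ε hε => ?_⟩
  have hpc : ContinuousAt p x₀ := by
    refine (PiLp.continuous_toLp 2 _).continuousAt.comp (continuousAt_pi.2 fun k => ?_)
    by_cases hk : k = j
    · simpa [hk] using (continuous_norm.continuousAt (x := x₀)).log (norm_ne_zero_iff.2 hx₀)
    · simpa [hk] using continuousAt_const
  obtain ⟨δ, hδ, hball⟩ := Metric.eventually_nhds_iff.1
    ((Metric.tendsto_nhds.1 hpc ε hε).and (isOpen_ne.mem_nhds hx₀))
  filter_upwards [hlim.eventually (eventually_exists_root_near hFc hFd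
    ((hF₀ x₀).trans hroot) hq hδ)] with t ht
  obtain ⟨z, hzd, hz⟩ := ht
  obtain ⟨hpz, hz0⟩ := hball hzd
  refine ⟨_, ⟨Z t z, ⟨fun k => mul_ne_zero ?_ ?_, hZ t z hz⟩, rfl⟩, ?_⟩
  · exact_mod_cast Real.exp_ne_zero _
  · split_ifs
    exacts [hz0, one_ne_zero]
  · rw [hlog t z hz0, dist_add_right, dist_comm]
    exact hpz

/-- The convex hull of a finite set of at least two lattice points in the plane has an edge (it may
be a segment): some nonzero weight attains its maximum at two distinct points. -/
theorem exists_weight_face_nontrivial {S : Finset (Fin 2 →₀ ℕ)} (hS : S.Nontrivial) :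
    ∃ (v : EuclideanSpace ℝ (Fin 2)) (M : ℝ) (i j : Fin 2), i ≠ j ∧ v i ≠ 0 ∧
      (∀ m ∈ S, v i * m i + v j * m j ≤ M) ∧
      ∃ m ∈ S, ∃ n ∈ S, m ≠ n ∧ v i * m i + v j * m j = M ∧ v i * n i + v j * n j = M := by
  classical
  obtain ⟨μ, hμ, hmax⟩ := S.exists_max_image (fun m => m 0) hS.nonempty
  by_cases hvert : ∃ m ∈ S, m ≠ μ ∧ m 0 = μ 0
  · obtain ⟨m, hm, hne, heq⟩ := hvert
    refine ⟨!₂[1, 0], μ 0, 0, 1, by decide, by simp, fun n hn => ?_, m, hm, μ, hμ, hne, ?_, ?_⟩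
    · simpa using hmax n hn
    · simp [heq]
    · simp
  · -- The rightmost point `μ` is unique: rotate a vertical supporting line about `μ` until it
    -- meets another point of `S`, where `slope` is extremal.
    push Not at hvert
    have hlt : ∀ m ∈ S, m ≠ μ → (0 : ℝ) < μ 0 - m 0 := fun m hm hne =>
      sub_pos.2 (by exact_mod_cast lt_of_le_of_ne (hmax m hm) (hvert m hm hne))
    let slope : (Fin 2 →₀ ℕ) → ℝ := fun m => ((m 1 : ℝ) - μ 1) / (μ 0 - m 0)
    obtain ⟨n, hn, hne⟩ := hS.exists_ne μ
    obtain ⟨m, hm, hslope⟩ := (S.erase μ).exists_max_image slope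
      ⟨n, Finset.mem_erase.2 ⟨hne, hn⟩⟩
    obtain ⟨hmμ, hmS⟩ := Finset.mem_erase.1 hm
    refine ⟨!₂[slope m, 1], slope m * μ 0 + μ 1, 1, 0, by decide, by simp, fun n hn => ?_,
      m, hmS, μ, hμ, hmμ, ?_, ?_⟩
    · by_cases hnμ : n = μ
      · simp [hnμ, add_comm]
      · have := (div_le_iff₀ (hlt n hn hnμ)).1 (hslope n (Finset.mem_erase.2 ⟨hnμ, hn⟩))
        simp
        linarith
    · have : slope m * (μ 0 - m 0) = m 1 - μ 1 := div_mul_cancel₀ _ (hlt m hmS hmμ).ne'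
      simp
      linarith
    · simp [add_comm]

theorem exists_hasTentacle_amoeba_of_not_isMonomialTerm {h : MvPolynomial (Fin 2) ℂ}
    (hh : ¬ IsMonomialTerm h) : ∃ v, HasTentacle (amoeba h) v := by
  by_cases h0 : h = 0
  · -- The amoeba of the zero polynomial is the whole plane.
    refine ⟨!₂[1, 0], fun hv => ?_, 0, fun ε hε => Eventually.of_forall fun t => ?_⟩
    · simpa using congrArg (fun w : EuclideanSpace ℝ (Fin 2) => w 0) hv
    · refine ⟨_, ⟨fun k => (Real.exp ((0 + t • !₂[(1 : ℝ), 0] : EuclideanSpace ℝ (Fin 2)) k) : ℝ),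
        ⟨fun k => Complex.ofReal_ne_zero.2 (Real.exp_ne_zero _), by simp [h0]⟩, rfl⟩, ?_⟩
      convert hε
      rw [dist_eq_zero]
      ext k
      simp [logMap, -Complex.ofReal_exp, abs_of_pos, Real.exp_pos]
  · have hS : h.support.Nontrivial := by
      by_contra hS
      rcases Finset.eq_empty_or_nonempty h.support with he | ⟨m, hm⟩
      · exact h0 (MvPolynomial.support_eq_empty.1 he)
      · refine hh ⟨m, h.coeff m, MvPolynomial.mem_support_iff.1 hm, ?_⟩
        ext n
        rw [MvPolynomial.coeff_monomial]
        split_ifs with hmn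
        · rw [hmn]
        · by_contra hn
          exact hS ⟨m, hm, n, MvPolynomial.mem_support_iff.2 hn, hmn⟩
    obtain ⟨v, M, i, j, hij, hvi, hle, hface⟩ := exists_weight_face_nontrivial hS
    exact ⟨v, hasTentacle_amoeba_of_face h v M hij hvi hle hface⟩

/-! ### Common divisors -/

theorem amoeba_subset_of_dvd {h f : MvPolynomial (Fin 2) ℂ} (hf : h ∣ f) :
    amoeba h ⊆ amoeba f := by
  obtain ⟨k, rfl⟩ := hf
  exact Set.image_mono fun z hz => ⟨hz.1, by rw [map_mul, hz.2, zero_mul]⟩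

theorem HasTentacle.mono {A B : Set (EuclideanSpace ℝ (Fin 2))} {v : EuclideanSpace ℝ (Fin 2)}
    (hA : HasTentacle A v) (hAB : A ⊆ B) : HasTentacle B v := by
  obtain ⟨hv, p, hp⟩ := hA
  exact ⟨hv, p, fun ε hε => (hp ε hε).mono fun t ⟨a, ha, hd⟩ => ⟨a, hAB ha, hd⟩⟩

theorem mainTheorem5 (f g : MvPolynomial (Fin 2) ℂ)
    (hfg : ∀ v : EuclideanSpace ℝ (Fin 2),
      ¬ (HasTentacle (amoeba f) v ∧ HasTentacle (amoeba g) v)) :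
    (∀ h : MvPolynomial (Fin 2) ℂ, h ∣ f → h ∣ g → IsMonomialTerm h) ∧
    ((∀ i : Fin 2, ¬ (MvPolynomial.X i ∣ f ∧ MvPolynomial.X i ∣ g)) → IsRelPrime f g) := by
  have hmono : ∀ h : MvPolynomial (Fin 2) ℂ, h ∣ f → h ∣ g → IsMonomialTerm h := by
    intro h hf hg
    by_contra hh
    obtain ⟨v, hv⟩ := exists_hasTentacle_amoeba_of_not_isMonomialTerm hh
    exact hfg v ⟨hv.mono (amoeba_subset_of_dvd hf), hv.mono (amoeba_subset_of_dvd hg)⟩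
  refine ⟨hmono, fun hX h hf hg => ?_⟩
  obtain ⟨s, c, hc, rfl⟩ := hmono h hf hg
  have hs : s = 0 := by
    ext i
    by_contra hi
    have hdvd : MvPolynomial.X i ∣ MvPolynomial.monomial s c :=
      MvPolynomial.X_dvd_monomial.2 (Or.inr hi)
    exact hX i ⟨hdvd.trans hf, hdvd.trans hg⟩
  rw [hs]
  exact (isUnit_iff_ne_zero.2 hc).map MvPolynomial.C
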